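/- Let $K$ be a real symmetric positive definite $n\times n$ matrix. For $S,T\subseteq[1:n]=\{1,\dots,n\}$ let $K(S,T)$ be the submatrix of $K$ with rows indexed by $S$ and columns indexed by $T$, let $K(S)=K(S,S)$, let $|\cdot|$ denote the determinant (the determinant of the empty matrix is $1$), and let $S^{\mathrm c}=[1:n]\setminus S$. Let $k,p\in[1:n]$ with $k\le p$, and let $P=[1:p]$. Then $$|K|\;\le\;|K(P^{\mathrm c})|\Bigg(\prod_{S\subseteq P:\,|S|=k}\frac{|K(S\cup P^{\mathrm c})|}{|K(P^{\mathrm c})|}\Bigg)^{1/\binom{p-1}{k-1}}\;\le\;\Bigg(\prod_{S\subseteq[1:n]:\,|S|=k}|K(S)|\Bigg)^{1/\binom{n-1}{k-1}},$$ where the last expression is the bound on $|K|$ in Szász's inequality. Moreover: 1. If $k<p$, equality holds in the first inequality if and only if the Schur complement $K(P)-K(P,P^{\mathrm c})K(P^{\mathrm c})^{-1}K(P^{\mathrm c},P)$ of $K(P^{\mathrm c})$ in $K$ is diagonal. 2. If $k=1$ and $p<n$, equality holds in the second inequality if and only if $K(P,P^{\mathrm c})=0$ and $K(P^{\mathrm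 c})$ is diagonal. 3. If $2\le k\le p<n$, equality holds in the second inequality if and only if $K$ is diagonal. 4. If $p=n$, equality holds in the second inequality. 5. If $k=1$, the middle expression equals $|K(P^{\mathrm c})|\prod_{i=1}^{p}\frac{|K(\{i\}\cup P^{\mathrm c})|}{|K(P^{\mathrm c})|}$, so that the first inequality becomes Ky Fan's inequality. -/

import Mathlib

/-- `K(S, T)`: the submatrix of `K` with rows indexed by `S` and columns indexed by `T`. -/
def subMat {n : ℕ} (K : Matrix (Fin n) (Fin n) ℝ) (S T : Finset (Fin n)) : Matrix S T ℝ :=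
  K.submatrix (fun i : S => (i : Fin n)) (fun j : T => (j : Fin n))

/-- `|K(S)|`: the determinant of the principal submatrix `K(S) = K(S, S)`; it is `1` for `S = ∅`. -/
def minorDet {n : ℕ} (K : Matrix (Fin n) (Fin n) ℝ) (S : Finset (Fin n)) : ℝ :=
  (subMat K S S).det

/-- The set of the first `p` of the `n` indices, `P = [1 : p]` (indices are shifted to start at 0). -/
def firstIdx (n p : ℕ) : Finset (Fin n) :=
  Finset.univ.filter (fun i : Fin n => (i : ℕ) < p)

/-- The Schur complement `K(P) - K(P, Pᶜ) K(Pᶜ)⁻¹ K(Pᶜ, P)` of `K(Pᶜ)` in `K`. -/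
noncomputable def schurCompl {n : ℕ} (K : Matrix (Fin n) (Fin n) ℝ) (P : Finset (Fin n)) :
    Matrix P P ℝ :=
  subMat K P P - subMat K P Pᶜ * (subMat K Pᶜ Pᶜ)⁻¹ * subMat K Pᶜ P

/-- The conditional bound
`|K(Pᶜ)| (∏_{S ⊆ P, |S| = k} |K(S ∪ Pᶜ)| / |K(Pᶜ)|) ^ (1 / C(p - 1, k - 1))` with `P = [1 : p]`. -/
noncomputable def condSzaszBound {n : ℕ} (K : Matrix (Fin n) (Fin n) ℝ) (p k : ℕ) : ℝ :=
  minorDet K (firstIdx n p)ᶜ *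
    (∏ S ∈ (firstIdx n p).powersetCard k,
      minorDet K (S ∪ (firstIdx n p)ᶜ) / minorDet K (firstIdx n p)ᶜ) ^
        ((1 : ℝ) / ((p - 1).choose (k - 1) : ℝ))

/-- The bound in the classical inequality of Szász:
`(∏_{S ⊆ [1 : n], |S| = k} |K(S)|) ^ (1 / C(n - 1, k - 1))`. -/
noncomputable def szaszBound {n : ℕ} (K : Matrix (Fin n) (Fin n) ℝ) (k : ℕ) : ℝ :=
  (∏ S ∈ (Finset.univ : Finset (Fin n)).powersetCard k, minorDet K S) ^
    ((1 : ℝ) / ((n - 1).choose (k - 1) : ℝ))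

/-! The set function `g S = log |K(S)|` is submodular, because `g (C ∪ S) - g C` is the logarithm of a
minor of a Schur complement and a `2 × 2` minor is at most the product of its diagonal entries.
After taking logarithms, the second inequality compares averages of `g` over the `k`-subsets of `P`,
conditioned on `C = Pᶜ`, with averages over the `k`-subsets of `C ∪ P`. By induction on `C` one may
condition on a single `j`; then the difference is a nonnegative combination of the terms
`g S - ∑ x ∈ S, (g (jS) - g (jS \ x))` and `g S + g j - g (jS)`, where `jS = {j} ∪ S`, and all of
these are nonnegative. For `|P| = k` the second inequality is Han's inequality, which applied to
`S ↦ g (C ∪ S) - g C` is the first one. If a term of the first kind vanishes, then `x` contributes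
the same increment to `∅` as to `jS \ x`, hence `g {x, y} = g {x} + g {y}` for the other `y` in
`jS`, and for a `2 × 2` minor this means `K x y = 0`. -/

section SetFunction

open Finset

variable {α : Type*} {f g : Finset α → ℝ} {A C P S : Finset α} {x y j : α} {k m : ℕ}

/-- Han's upper bound on `g P` in terms of the values of `g` on the subsets of size `k` of `P`. -/
noncomputable def hanBound (g : Finset α → ℝ) (P : Finset α) (k : ℕ) : ℝ :=
  (∑ S ∈ P.powersetCard k, g S) / ((#P - 1).choose (k - 1) : ℝ)

theorem hanBound_congr (h : ∀ S ∈ P.powersetCard k, f S = g S) :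
    hanBound f P k = hanBound g P k := by
  rw [hanBound, hanBound, sum_congr rfl h]

theorem hanBound_card (g : Finset α → ℝ) (P : Finset α) : hanBound g P #P = g P := by
  simp [hanBound]

theorem hanBound_neg (g : Finset α → ℝ) (P : Finset α) (k : ℕ) :
    hanBound (fun S => -g S) P k = -hanBound g P k := by
  simp [hanBound, neg_div]

variable [DecidableEq α]

/-- Submodularity of a set function, in the form of diminishing returns. -/
def IsSubmodular (g : Finset α → ℝ) : Prop :=
  ∀ ⦃A B : Finset α⦄, A ⊆ B → ∀ i ∉ B, g (insert i B) + g A ≤ g (insert i A) + g B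

/-- The contraction of `g` by `C`. If `g` is an entropy, then `contract g C` is the conditional
entropy given the variables in `C`. -/
def contract (g : Finset α → ℝ) (C S : Finset α) : ℝ := g (C ∪ S) - g C

theorem contract_empty_left (h0 : g ∅ = 0) : contract g ∅ = g := by
  ext S
  simp [contract, h0]

theorem contract_empty_right : contract g C ∅ = 0 := by simp [contract]

theorem contract_contract (g : Finset α → ℝ) (C D : Finset α) :
    contract (contract g C) D = contract g (C ∪ D) := by
  ext S
  simp [contract, union_assoc]

theorem sum_powersetCard_sum_erase (f : Finset α → ℝ) (P : Finset α) (m : ℕ) :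
    ∑ S ∈ P.powersetCard (m + 1), ∑ x ∈ S, f (S.erase x) =
      ∑ R ∈ P.powersetCard m, ((#P : ℝ) - m) * f R := by
  have hcard : ∀ R ∈ P.powersetCard m, ((#P : ℝ) - m) * f R = ∑ _x ∈ P \ R, f R := by
    intro R hR
    obtain ⟨hRP, rfl⟩ := mem_powersetCard.1 hR
    rw [sum_const, nsmul_eq_mul, card_sdiff_of_subset hRP, Nat.cast_sub (card_le_card hRP)]
  rw [sum_congr rfl hcard, sum_sigma', sum_sigma']
  refine sum_bij' (fun p _ => ⟨p.1.erase p.2, p.2⟩) (fun p _ => ⟨insert p.2 p.1, p.2⟩)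
    ?_ ?_ ?_ ?_ fun _ _ => rfl
  all_goals
    rintro ⟨S, x⟩ h
    simp only [mem_sigma, mem_powersetCard, mem_sdiff] at h ⊢
  · obtain ⟨⟨hSP, hS⟩, hx⟩ := h
    exact ⟨⟨(erase_subset x S).trans hSP, by simp [card_erase_of_mem hx, hS]⟩, hSP hx, by simp⟩
  · obtain ⟨⟨hSP, hS⟩, hxP, hx⟩ := h
    exact ⟨⟨insert_subset hxP hSP, by simp [hx, hS]⟩, mem_insert_self x S⟩
  · simp [insert_erase h.2]
  · simp [erase_insert h.2.2]

theorem sum_powersetCard_insert (f : Finset α → ℝ) (hj : j ∉ P) (m : ℕ) :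
    ∑ S ∈ (insert j P).powersetCard (m + 1), f S =
      ∑ S ∈ P.powersetCard (m + 1), f S + ∑ R ∈ P.powersetCard m, f ({j} ∪ R) := by
  have hnot : ∀ {k : ℕ}, ∀ R ∈ P.powersetCard k, j ∉ R := fun R hR h =>
    hj ((mem_powersetCard.1 hR).1 h)
  rw [powersetCard_succ_insert hj, sum_union, sum_image]
  · simp only [singleton_union]
  · intro R hR R' hR' h
    rw [← erase_insert (hnot R hR), h, erase_insert (hnot R' hR')]
  · rw [disjoint_left]
    rintro S hS hS'
    obtain ⟨R, -, rfl⟩ := mem_image.1 hS'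
    exact hnot _ hS (mem_insert_self j R)

theorem isSubmodular_of_insert_insert
    (h : ∀ (A : Finset α) (i j : α), i ∉ A → j ∉ A → i ≠ j →
      g (insert i (insert j A)) + g A ≤ g (insert i A) + g (insert j A)) :
    IsSubmodular g := by
  intro A B hAB i hi
  obtain ⟨D, rfl⟩ : ∃ D, A ∪ D = B := ⟨B \ A, union_sdiff_of_subset hAB⟩
  clear hAB
  induction D using Finset.induction_on with
  | empty => simp
  | insert d D _ ih =>
    rw [union_insert] at hi ⊢
    obtain ⟨hid, hi⟩ : i ≠ d ∧ i ∉ A ∪ D := by simpa only [mem_insert, not_or] using hi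
    by_cases hdA : d ∈ A ∪ D
    · rw [insert_eq_of_mem hdA]
      exact ih hi
    · linarith [ih hi, h (A ∪ D) i d hi hdA hid]

theorem sum_powersetCard_sum_sub_erase (g : Finset α → ℝ) (A P : Finset α) (m : ℕ) :
    ∑ S ∈ P.powersetCard (m + 1), ∑ x ∈ S, (g (A ∪ S) - g (A ∪ S.erase x)) =
      (m + 1) * ∑ S ∈ P.powersetCard (m + 1), g (A ∪ S) -
        (#P - m) * ∑ R ∈ P.powersetCard m, g (A ∪ R) := by
  simp only [sum_sub_distrib]
  rw [sum_powersetCard_sum_erase fun R => g (A ∪ R), mul_sum, mul_sum]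
  congr 1
  refine sum_congr rfl fun S hS => ?_
  simp [(mem_powersetCard.1 hS).2]

theorem hanBound_insert_sub_eq (g : Finset α → ℝ) (hj : j ∉ P) (hm : m + 1 ≤ #P) :
    (#P * (#P - 1).choose m : ℝ) *
        (hanBound g (insert j P) (m + 1) - (g {j} + hanBound (contract g {j}) P (m + 1))) =
      ∑ S ∈ P.powersetCard (m + 1), (g S - ∑ x ∈ S, (g ({j} ∪ S) - g ({j} ∪ S.erase x))) +
        (#P - (m + 1)) * ∑ S ∈ P.powersetCard (m + 1), (g S + g {j} - g ({j} ∪ S)) := by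
  obtain ⟨q, hq⟩ : ∃ q, #P = q + 1 := ⟨#P - 1, by omega⟩
  have hmq : m ≤ q := by omega
  have hpos : (0 : ℝ) < q.choose m := by exact_mod_cast Nat.choose_pos hmq
  have hpos' : (0 : ℝ) < (q + 1).choose m := by exact_mod_cast Nat.choose_pos (by omega)
  have hlow : (q.choose m : ℝ) * (q + 1) = (q + 1).choose m * (q + 1 - m) := by
    have := congrArg (Nat.cast (R := ℝ)) (Nat.choose_mul_succ_eq q m)
    push_cast [Nat.cast_sub (hmq.trans q.le_succ)] at this
    exact this
  have hhigh : (q + 1 : ℝ) * q.choose m = (q + 1).choose (m + 1) * (m + 1) := by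
    exact_mod_cast Nat.add_one_mul_choose_eq q m
  rw [sum_sub_distrib, sum_powersetCard_sum_sub_erase]
  simp only [hanBound, sum_powersetCard_insert g hj, contract, sum_sub_distrib, sum_add_distrib,
    sum_const, card_powersetCard, card_insert_of_notMem hj, hq, nsmul_eq_mul, Nat.add_sub_cancel]
  push_cast
  set X := ∑ S ∈ P.powersetCard (m + 1), g S
  set Y := ∑ S ∈ P.powersetCard (m + 1), g ({j} ∪ S)
  set Z := ∑ R ∈ P.powersetCard m, g ({j} ∪ R)
  have hXZ : (q + 1) * (q.choose m : ℝ) * ((X + Z) / (q + 1).choose m) =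
      (q + 1 - m) * (X + Z) := by
    field_simp
    linear_combination (X + Z) * hlow
  have hY : (q + 1) * (q.choose m : ℝ) * ((Y - (q + 1).choose (m + 1) * g {j}) / q.choose m) =
      (q + 1) * (Y - (q + 1).choose (m + 1) * g {j}) := by
    field_simp
  linear_combination hXZ - hY - g {j} * hhigh

namespace IsSubmodular

protected theorem contract (hg : IsSubmodular g) (C : Finset α) : IsSubmodular (contract g C) := by
  intro A B hAB i hi
  simp only [contract, union_insert]
  by_cases hiC : i ∈ C
  · rw [insert_eq_of_mem (mem_union_left B hiC), insert_eq_of_mem (mem_union_left A hiC), add_comm]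
  · have := hg (union_subset_union_right hAB : C ∪ A ⊆ C ∪ B) i (by simp [hi, hiC])
    linarith

theorem sum_sub_erase_le (hg : IsSubmodular g) (hCA : C ⊆ A) (hAS : Disjoint A S) :
    ∑ x ∈ S, (g (A ∪ S) - g (A ∪ S.erase x)) ≤ g (C ∪ S) - g C := by
  induction S using Finset.induction_on generalizing A with
  | empty => simp
  | insert a S ha ih =>
    obtain ⟨haA, hAS⟩ := disjoint_insert_right.1 hAS
    have hrest : ∑ x ∈ S, (g (A ∪ insert a S) - g (A ∪ (insert a S).erase x)) =
        ∑ x ∈ S, (g (insert a A ∪ S) - g (insert a A ∪ S.erase x)) := by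
      refine sum_congr rfl fun x hx => ?_
      have hax : a ≠ x := fun h => ha (h ▸ hx)
      rw [erase_insert_of_ne hax, insert_union, insert_union, union_insert, union_insert]
    rw [sum_insert ha, erase_insert ha, hrest, union_insert, union_insert]
    have hfirst := hg (union_subset_union_left hCA : C ∪ S ⊆ A ∪ S) a (by simp [haA, ha])
    have := ih (hCA.trans (subset_insert a A)) (disjoint_insert_left.2 ⟨ha, hAS⟩)
    linarith

theorem singleton_sub_le_of_sum_eq (hg : IsSubmodular g) (hAS : Disjoint A S)
    (h : ∑ x ∈ S, (g (A ∪ S) - g (A ∪ S.erase x)) = g S - g ∅) (hx : x ∈ S) :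
    g {x} - g ∅ ≤ g (A ∪ S) - g (A ∪ S.erase x) := by
  have hxA : x ∉ A := disjoint_right.1 hAS hx
  have hrest := hg.sum_sub_erase_le (C := {x}) (A := insert x A) (S := S.erase x) (by simp)
    (disjoint_insert_left.2 ⟨notMem_erase x S, hAS.mono_right (erase_subset x S)⟩)
  have hset : ∀ y ∈ S.erase x, insert x A ∪ (S.erase x).erase y = A ∪ S.erase y := by
    intro y hy
    rw [insert_union, ← union_insert, erase_right_comm,
      insert_erase (mem_erase.2 ⟨(ne_of_mem_erase hy).symm, hx⟩)]
  rw [sum_congr rfl fun y hy => by rw [hset y hy], singleton_union, insert_union, ← union_insert,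
    insert_erase hx] at hrest
  rw [← add_sum_erase S _ hx] at h
  linarith

/-- Equality forces every `x ∈ S` to contribute the same increment after all the other elements of
`A ∪ S` as it does on its own, hence also after any one of them. -/
theorem pair_eq_of_sum_eq (hg : IsSubmodular g) (hAS : Disjoint A S)
    (h : ∑ x ∈ S, (g (A ∪ S) - g (A ∪ S.erase x)) = g S - g ∅) (hx : x ∈ S)
    (hy : y ∈ A ∪ S) (hxy : x ≠ y) : g {x, y} + g ∅ = g {x} + g {y} := by
  have hxrest : x ∉ A ∪ S.erase x := by simp [disjoint_right.1 hAS hx]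
  have hyrest : {y} ⊆ A ∪ S.erase x := by
    rw [← erase_eq_of_notMem (disjoint_right.1 hAS hx), ← erase_union_distrib]
    simpa using ⟨hxy.symm, by simpa using hy⟩
  have hlower := hg hyrest x hxrest
  have hupper := hg (empty_subset {y}) x (by simpa using hxy)
  have := hg.singleton_sub_le_of_sum_eq hAS h hx
  rw [← union_insert, insert_erase hx] at hlower
  rw [insert_empty] at hupper
  linarith

theorem sum_sub_sum_sub_erase_le (hg : IsSubmodular g) (h0 : g ∅ = 0)
    (hj : j ∉ P) (hm : m + 1 ≤ #P) :
    ∑ S ∈ P.powersetCard (m + 1), (g S - ∑ x ∈ S, (g ({j} ∪ S) - g ({j} ∪ S.erase x))) ≤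
      #P * (#P - 1).choose m *
        (hanBound g (insert j P) (m + 1) - (g {j} + hanBound (contract g {j}) P (m + 1))) := by
  have hcard : (0 : ℝ) ≤ #P - (m + 1) := sub_nonneg.2 (by exact_mod_cast hm)
  rw [hanBound_insert_sub_eq g hj hm]
  refine le_add_of_nonneg_right (mul_nonneg hcard (sum_nonneg fun S hS => ?_))
  have := hg (empty_subset S) j fun h => hj ((mem_powersetCard.1 hS).1 h)
  rw [singleton_union]
  rw [insert_empty] at this
  linarith

theorem sub_sum_sub_erase_nonneg (hg : IsSubmodular g) (h0 : g ∅ = 0) (hj : j ∉ S) :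
    0 ≤ g S - ∑ x ∈ S, (g ({j} ∪ S) - g ({j} ∪ S.erase x)) := by
  have := hg.sum_sub_erase_le (empty_subset {j}) (disjoint_singleton_left.2 hj)
  rw [empty_union, h0] at this
  linarith

theorem add_hanBound_contract_singleton_le (hg : IsSubmodular g) (h0 : g ∅ = 0) (hj : j ∉ P)
    (hk : 1 ≤ k) (hkP : k ≤ #P) :
    g {j} + hanBound (contract g {j}) P k ≤ hanBound g (insert j P) k := by
  obtain ⟨m, rfl⟩ := Nat.exists_eq_add_of_le' hk
  have hpos : (0 : ℝ) < #P * (#P - 1).choose m :=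
    mul_pos (by exact_mod_cast (by omega : 0 < #P))
      (by exact_mod_cast Nat.choose_pos (by omega))
  have hgap := (sum_nonneg fun S hS =>
    hg.sub_sum_sub_erase_nonneg h0 fun hjS => hj ((mem_powersetCard.1 hS).1 hjS)).trans
    (hg.sum_sub_sum_sub_erase_le h0 hj hkP)
  exact sub_nonneg.1 (nonneg_of_mul_nonneg_right hgap hpos)

theorem sum_sub_erase_eq_of_add_hanBound_contract_singleton_eq (hg : IsSubmodular g)
    (h0 : g ∅ = 0) (hj : j ∉ P) (hk : 1 ≤ k) (hkP : k ≤ #P)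
    (h : g {j} + hanBound (contract g {j}) P k = hanBound g (insert j P) k)
    (hS : S ∈ P.powersetCard k) :
    ∑ x ∈ S, (g ({j} ∪ S) - g ({j} ∪ S.erase x)) = g S := by
  obtain ⟨m, rfl⟩ := Nat.exists_eq_add_of_le' hk
  have hnonneg := fun S (hS : S ∈ P.powersetCard (m + 1)) =>
    hg.sub_sum_sub_erase_nonneg h0 fun hjS => hj ((mem_powersetCard.1 hS).1 hjS)
  have hle := hg.sum_sub_sum_sub_erase_le h0 hj hkP
  rw [h, sub_self, mul_zero] at hle
  have hzero := (sum_eq_zero_iff_of_nonneg hnonneg).1 (hle.antisymm (sum_nonneg hnonneg)) S hS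
  exact (sub_eq_zero.1 hzero).symm

theorem pair_eq_of_add_hanBound_contract_singleton_eq (hg : IsSubmodular g) (h0 : g ∅ = 0)
    (hj : j ∉ P) (hk : 1 ≤ k) (hkP : k ≤ #P)
    (h : g {j} + hanBound (contract g {j}) P k = hanBound g (insert j P) k)
    (hx : x ∈ insert j P) (hy : y ∈ insert j P) (hxy : x ≠ y) (hxk : x = j ∨ 2 ≤ k) :
    g {x, y} = g {x} + g {y} := by
  have hcard : #(({x, y} : Finset α).erase j) ≤ k := by
    rcases hxk with rfl | hk2
    · rwa [erase_insert (by simpa using hxy), card_singleton]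
    · exact (card_erase_le.trans card_le_two).trans hk2
  obtain ⟨S, hxyS, hSP, hS⟩ := exists_subsuperset_card_eq
    (subset_insert_iff.1 (insert_subset hx (singleton_subset_iff.2 hy))) hcard hkP
  have hsum := hg.sum_sub_erase_eq_of_add_hanBound_contract_singleton_eq h0 hj hk hkP h
    (mem_powersetCard.2 ⟨hSP, hS⟩)
  have hpair : ∀ x ∈ S, ∀ y ∈ {j} ∪ S, x ≠ y → g {x, y} = g {x} + g {y} := by
    intro x hx y hy hxy
    have := hg.pair_eq_of_sum_eq (disjoint_singleton_left.2 fun hjS => hj (hSP hjS))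
      (by rw [hsum, h0, sub_zero]) hx hy hxy
    rwa [h0, add_zero] at this
  rw [← subset_insert_iff, insert_subset_iff, singleton_subset_iff] at hxyS
  simp only [← singleton_union j] at hxyS
  obtain ⟨hxS, hyS⟩ := hxyS
  by_cases hxj : x = j
  · have hy : y ∈ S := by simpa [hxj ▸ hxy.symm] using hyS
    rw [pair_comm, add_comm]
    exact hpair y hy x hxS hxy.symm
  · exact hpair x (by simpa [hxj] using hxS) y hyS hxy

theorem add_hanBound_contract_le (hg : IsSubmodular g) (h0 : g ∅ = 0) (hCP : Disjoint C P)
    (hk : 1 ≤ k) (hkP : k ≤ #P) :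
    g C + hanBound (contract g C) P k ≤ hanBound g (C ∪ P) k := by
  induction C using Finset.induction_on generalizing P with
  | empty => simp [contract_empty_left h0, h0]
  | insert j C hjC ih =>
    obtain ⟨hjP, hCP⟩ := disjoint_insert_left.1 hCP
    have hstep := (hg.contract C).add_hanBound_contract_singleton_le contract_empty_right hjP hk hkP
    have hrest := ih (disjoint_insert_right.2 ⟨hjC, hCP⟩)
      (hkP.trans (card_le_card (subset_insert j P)))
    rw [contract_contract, union_singleton, contract, union_singleton] at hstep
    rw [union_insert] at hrest
    rw [insert_union]
    linarith

theorem pair_eq_of_add_hanBound_contract_eq (hg : IsSubmodular g) (h0 : g ∅ = 0)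
    (hCP : Disjoint C P) (hC : C.Nonempty) (hk : 1 ≤ k) (hkP : k ≤ #P)
    (h : g C + hanBound (contract g C) P k = hanBound g (C ∪ P) k)
    (hx : x ∈ C ∪ P) (hy : y ∈ C ∪ P) (hxy : x ≠ y) (hxk : x ∈ C ∨ 2 ≤ k) :
    g {x, y} = g {x} + g {y} := by
  obtain ⟨j, hjC, hxj⟩ : ∃ j ∈ C, x = j ∨ 2 ≤ k := by
    rcases hxk with hxC | hk2
    · exact ⟨x, hxC, .inl rfl⟩
    · exact hC.imp fun j hj => ⟨hj, .inr hk2⟩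
  have hjP : j ∉ P := disjoint_left.1 hCP hjC
  have hj : j ∉ C.erase j ∪ P := by simp [hjP]
  have hinsert : insert j (C.erase j ∪ P) = C ∪ P := by rw [← insert_union, insert_erase hjC]
  have hkP' : k ≤ #(C.erase j ∪ P) := hkP.trans (card_le_card subset_union_right)
  have hstep := hg.add_hanBound_contract_singleton_le h0 hj hk hkP'
  have hrest := (hg.contract {j}).add_hanBound_contract_le contract_empty_right
    (hCP.mono_left (erase_subset j C)) hk hkP
  rw [contract_contract, contract, singleton_union, insert_erase hjC] at hrest
  rw [← hinsert] at h hx hy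
  exact hg.pair_eq_of_add_hanBound_contract_singleton_eq h0 hj hk hkP' (by linarith) hx hy hxy hxj

theorem le_hanBound (hg : IsSubmodular g) (h0 : g ∅ = 0) (hk : 1 ≤ k) (hkP : k ≤ #P) :
    g P ≤ hanBound g P k := by
  obtain ⟨T, hTP, rfl⟩ := exists_subset_card_eq hkP
  have := hg.add_hanBound_contract_le h0 (sdiff_disjoint (s := T) (t := P)) hk le_rfl
  rwa [hanBound_card, contract, sdiff_union_of_subset hTP, add_sub_cancel] at this

theorem pair_eq_of_eq_hanBound (hg : IsSubmodular g) (h0 : g ∅ = 0) (hk : 1 ≤ k) (hkP : k < #P)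
    (h : g P = hanBound g P k) (hx : x ∈ P) (hy : y ∈ P) (hxy : x ≠ y) :
    g {x, y} = g {x} + g {y} := by
  obtain ⟨T, hTx, rfl⟩ := exists_subset_card_eq (s := P.erase x) (n := k)
    (by rw [card_erase_of_mem hx]; omega)
  have hTP := hTx.trans (erase_subset x P)
  have hxT : x ∈ P \ T := mem_sdiff.2 ⟨hx, fun hxT => notMem_erase x P (hTx hxT)⟩
  have hunion := sdiff_union_of_subset hTP
  refine hg.pair_eq_of_add_hanBound_contract_eq h0 (sdiff_disjoint (s := T) (t := P))
    ⟨x, hxT⟩ hk le_rfl ?_ (by rwa [hunion]) (by rwa [hunion]) hxy (.inl hxT)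
  rwa [hanBound_card, contract, hunion, add_sub_cancel]

end IsSubmodular

theorem isSubmodular_sum (d : α → ℝ) : IsSubmodular fun S => ∑ i ∈ S, d i := by
  intro A B hAB i hi
  beta_reduce
  rw [sum_insert hi, sum_insert fun h => hi (hAB h)]
  linarith

omit [DecidableEq α] in
/-- Both `S ↦ ∑ i ∈ S, d i` and its negative are submodular, so Han's inequality for the two gives
both bounds. -/
theorem hanBound_sum (d : α → ℝ) (hk : 1 ≤ k) (hkP : k ≤ #P) :
    hanBound (fun S => ∑ i ∈ S, d i) P k = ∑ i ∈ P, d i := by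
  classical
  have hle := (isSubmodular_sum d).le_hanBound sum_empty hk hkP
  have hge := (isSubmodular_sum fun i => -d i).le_hanBound sum_empty hk hkP
  simp only [sum_neg_distrib, hanBound_neg] at hge
  linarith

end SetFunction

section PrincipalMinor

open Finset Matrix

variable {ι R : Type*} [CommRing R] {M : Matrix ι ι R} {S A : Finset ι} {i j : ι}

theorem isDiag_submatrix_coe_iff :
    (M.submatrix ((↑) : S → ι) (↑)).IsDiag ↔ ∀ x ∈ S, ∀ y ∈ S, x ≠ y → M x y = 0 :=
  ⟨fun h x hx y hy hxy => @h ⟨x, hx⟩ ⟨y, hy⟩ fun h => hxy (congrArg Subtype.val h),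
    fun h x y hxy => h x x.2 y y.2 (Subtype.coe_ne_coe.2 hxy)⟩

variable [DecidableEq ι]

/-- The principal minor of `M` with rows and columns in `S`. -/
def principalMinor (M : Matrix ι ι R) (S : Finset ι) : R :=
  (M.submatrix ((↑) : S → ι) (↑)).det

/-- The Schur complement of `M(A)` in `M`: if `M` is the covariance matrix of a Gaussian vector,
this is the conditional covariance matrix given the coordinates in `A`. It is indexed by all of `ι`,
so that its principal minors are again a set function on `ι`. -/
noncomputable def condCov (M : Matrix ι ι R) (A : Finset ι) : Matrix ι ι R :=
  M - M.submatrix id ((↑) : A → ι) * (M.submatrix ((↑) : A → ι) ((↑) : A → ι))⁻¹ *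
    M.submatrix ((↑) : A → ι) id

@[simp]
theorem principalMinor_empty (M : Matrix ι ι R) : principalMinor M ∅ = 1 := det_isEmpty

@[simp]
theorem principalMinor_singleton (M : Matrix ι ι R) (i : ι) : principalMinor M {i} = M i i := by
  simp [principalMinor]

theorem principalMinor_pair (hij : i ≠ j) (M : Matrix ι ι R) :
    principalMinor M {i, j} = M i i * M j j - M i j * M j i := by
  let e : Fin 2 ≃ ({i, j} : Finset ι) :=
    Equiv.ofBijective ![⟨i, by simp⟩, ⟨j, by simp⟩] (by
      constructor
      · intro x y
        fin_cases x <;> fin_cases y <;> simp [hij, hij.symm]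
      · rintro ⟨x, hx⟩
        rcases mem_insert.1 hx with rfl | hx
        · exact ⟨0, rfl⟩
        · exact ⟨1, by simp [mem_singleton.1 hx]⟩)
  rw [principalMinor, ← det_submatrix_equiv_self e, det_fin_two]
  rfl

theorem principalMinor_univ [Fintype ι] (M : Matrix ι ι R) : principalMinor M univ = M.det :=
  det_submatrix_equiv_self (Equiv.subtypeUnivEquiv mem_univ) M

theorem principalMinor_eq_prod (h : ∀ x ∈ S, ∀ y ∈ S, x ≠ y → M x y = 0) :
    principalMinor M S = ∏ x ∈ S, M x x := by
  rw [principalMinor, ← (isDiag_submatrix_coe_iff.2 h).diagonal_diag, det_diagonal]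
  exact prod_coe_sort S fun x => M x x

theorem principalMinor_union (hAS : Disjoint A S) (hA : IsUnit (principalMinor M A)) :
    principalMinor M (A ∪ S) = principalMinor M A * principalMinor (condCov M A) S := by
  let := invertibleOfIsUnitDet _ hA
  have hblocks : (M.submatrix ((↑) : ↥(A ∪ S) → ι) (↑)).submatrix
      (Equiv.Finset.union A S hAS) (Equiv.Finset.union A S hAS) =
        fromBlocks (M.submatrix (↑) (↑)) (M.submatrix (↑) (↑))
          (M.submatrix (↑) (↑)) (M.submatrix (↑) (↑)) := by
    ext (x | x) (y | y) <;> rfl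
  rw [principalMinor, ← det_submatrix_equiv_self (Equiv.Finset.union A S hAS), hblocks,
    det_fromBlocks₁₁, invOf_eq_nonsing_inv]
  rfl

theorem isSymm_condCov (hM : M.IsSymm) : (condCov M A).IsSymm := by
  simp only [condCov, IsSymm, transpose_sub, transpose_mul, transpose_nonsing_inv,
    transpose_submatrix, hM.eq, Matrix.mul_assoc]

end PrincipalMinor

section CondSzasz

open Finset Matrix

variable {ι : Type*} {K M : Matrix ι ι ℝ} {A C P S : Finset ι} {i j : ι} {k : ℕ}

theorem isSymm_of_posDef (hK : K.PosDef) : K.IsSymm :=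
  isHermitian_iff_isSymm.1 hK.isHermitian

variable [DecidableEq ι]

/-- The logarithm of a principal minor: up to an additive multiple of `#S`, twice the entropy of the
coordinates in `S` of a Gaussian vector with covariance matrix `M`. -/
noncomputable def logMinor (M : Matrix ι ι ℝ) (S : Finset ι) : ℝ :=
  Real.log (principalMinor M S)

theorem logMinor_empty (M : Matrix ι ι ℝ) : logMinor M ∅ = 0 := by simp [logMinor]

theorem logMinor_eq_sum (hpos : ∀ x ∈ S, 0 < principalMinor M {x})
    (h : ∀ x ∈ S, ∀ y ∈ S, x ≠ y → M x y = 0) : logMinor M S = ∑ x ∈ S, Real.log (M x x) := by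
  rw [logMinor, principalMinor_eq_prod h,
    Real.log_prod fun x hx => (principalMinor_singleton M x ▸ hpos x hx).ne']

theorem logMinor_singleton_add_singleton (hpos : ∀ S ⊆ {i, j}, 0 < principalMinor M S) :
    logMinor M {i} + logMinor M {j} = Real.log (M i i * M j j) := by
  have hi := hpos {i} (by simp)
  have hj := hpos {j} (by simp)
  rw [principalMinor_singleton] at hi hj
  rw [logMinor, logMinor, principalMinor_singleton, principalMinor_singleton,
    Real.log_mul hi.ne' hj.ne']

theorem logMinor_pair_le (hM : M.IsSymm) (hij : i ≠ j)
    (hpos : ∀ S ⊆ {i, j}, 0 < principalMinor M S) :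
    logMinor M {i, j} ≤ logMinor M {i} + logMinor M {j} := by
  rw [logMinor_singleton_add_singleton hpos]
  refine Real.log_le_log (hpos _ Subset.rfl) ?_
  rw [principalMinor_pair hij, hM.apply i j]
  exact sub_le_self _ (mul_self_nonneg _)

theorem logMinor_pair_eq_iff (hM : M.IsSymm) (hij : i ≠ j)
    (hpos : ∀ S ⊆ {i, j}, 0 < principalMinor M S) :
    logMinor M {i, j} = logMinor M {i} + logMinor M {j} ↔ M i j = 0 := by
  have hi := hpos {i} (by simp)
  have hj := hpos {j} (by simp)
  rw [principalMinor_singleton] at hi hj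
  rw [logMinor_singleton_add_singleton hpos, logMinor,
    Real.log_injOn_pos.eq_iff (hpos _ Subset.rfl) (mul_pos hi hj), principalMinor_pair hij,
    hM.apply i j, sub_eq_self, mul_self_eq_zero]

theorem forall_mem_compl_eq_zero_iff [Fintype ι] (hM : M.IsSymm) :
    (∀ x y, x ≠ y → x ∈ Pᶜ → M x y = 0) ↔
      M.submatrix ((↑) : P → ι) ((↑) : ↥Pᶜ → ι) = 0 ∧
        (M.submatrix ((↑) : ↥Pᶜ → ι) (↑)).IsDiag := by
  rw [isDiag_submatrix_coe_iff]
  constructor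
  · refine fun h => ⟨?_, fun x hx y _ hxy => h x y hxy hx⟩
    ext x y
    exact (hM.apply _ _).trans (h y x (fun hyx => mem_compl.1 y.2 (hyx ▸ x.2)) y.2)
  · rintro ⟨hzero, hdiag⟩ x y hxy hx
    by_cases hy : y ∈ P
    · exact (hM.apply _ _).trans (congrFun₂ hzero ⟨y, hy⟩ ⟨x, hx⟩)
    · exact hdiag x hx y (mem_compl.2 hy) hxy

theorem principalMinor_pos (hK : K.PosDef) (S : Finset ι) : 0 < principalMinor K S :=
  (hK.submatrix Subtype.val_injective).det_pos

theorem principalMinor_condCov_pos (hK : K.PosDef) (hAS : Disjoint A S) :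
    0 < principalMinor (condCov K A) S := by
  have hA := principalMinor_pos hK A
  have := principalMinor_pos hK (A ∪ S)
  rw [principalMinor_union hAS hA.ne'.isUnit] at this
  exact pos_of_mul_pos_right this hA.le

theorem contract_logMinor (hK : K.PosDef) (hAS : Disjoint A S) :
    contract (logMinor K) A S = logMinor (condCov K A) S := by
  have hA := principalMinor_pos hK A
  rw [contract, logMinor, principalMinor_union hAS hA.ne'.isUnit,
    Real.log_mul hA.ne' (principalMinor_condCov_pos hK hAS).ne', logMinor, logMinor,
    add_sub_cancel_left]

theorem isSubmodular_logMinor (hK : K.PosDef) : IsSubmodular (logMinor K) := by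
  refine isSubmodular_of_insert_insert fun A i j hi hj hij => ?_
  have hA : ∀ S ⊆ {i, j}, Disjoint A S := fun S hS =>
    Disjoint.mono_right hS (by simp [hi, hj])
  have hpair := logMinor_pair_le (isSymm_condCov (A := A) (isSymm_of_posDef hK)) hij fun S hS =>
    principalMinor_condCov_pos hK (hA S hS)
  rw [← contract_logMinor hK (hA _ Subset.rfl), ← contract_logMinor hK (hA _ (by simp)),
    ← contract_logMinor hK (hA _ (by simp))] at hpair
  simp only [contract, union_insert, union_singleton] at hpair
  linarith

/-- The conditional Szász bound for the subsets of size `k` of `P`, given `C`. For `C = ∅` it is the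
bound in Szász's inequality for `K(P)`. -/
noncomputable def condSzasz (K : Matrix ι ι ℝ) (C P : Finset ι) (k : ℕ) : ℝ :=
  principalMinor K C *
    (∏ S ∈ P.powersetCard k, principalMinor K (S ∪ C) / principalMinor K C) ^
      ((1 : ℝ) / ((#P - 1).choose (k - 1) : ℝ))

theorem condSzasz_eq_exp (hK : K.PosDef) (C P : Finset ι) (k : ℕ) :
    condSzasz K C P k =
      Real.exp (logMinor K C + hanBound (contract (logMinor K) C) P k) := by
  have hratio : ∀ S, 0 < principalMinor K (S ∪ C) / principalMinor K C := fun S =>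
    div_pos (principalMinor_pos hK _) (principalMinor_pos hK C)
  have hlog : ∀ S, Real.log (principalMinor K (S ∪ C) / principalMinor K C) =
      contract (logMinor K) C S := fun S => by
    rw [Real.log_div (principalMinor_pos hK _).ne' (principalMinor_pos hK C).ne', union_comm]
    rfl
  rw [condSzasz, Real.exp_add, logMinor, Real.exp_log (principalMinor_pos hK C),
    Real.rpow_def_of_pos (prod_pos fun S _ => hratio S),
    Real.log_prod fun S _ => (hratio S).ne', sum_congr rfl fun S _ => hlog S, mul_one_div]
  rfl

theorem condSzasz_empty_eq_exp (hK : K.PosDef) (P : Finset ι) (k : ℕ) :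
    condSzasz K ∅ P k = Real.exp (hanBound (logMinor K) P k) := by
  rw [condSzasz_eq_exp hK, logMinor_empty, zero_add, contract_empty_left (logMinor_empty K)]

theorem principalMinor_union_eq_exp (hK : K.PosDef) (C P : Finset ι) :
    principalMinor K (C ∪ P) = Real.exp (logMinor K C + contract (logMinor K) C P) := by
  rw [contract, add_sub_cancel, logMinor, Real.exp_log (principalMinor_pos hK _)]

theorem principalMinor_union_le_condSzasz (hK : K.PosDef) (C : Finset ι) (hk : 1 ≤ k)
    (hkP : k ≤ #P) : principalMinor K (C ∪ P) ≤ condSzasz K C P k := by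
  rw [principalMinor_union_eq_exp hK, condSzasz_eq_exp hK, Real.exp_le_exp]
  exact add_le_add_right
    (((isSubmodular_logMinor hK).contract C).le_hanBound contract_empty_right hk hkP) _

theorem condSzasz_le_condSzasz_empty (hK : K.PosDef) (hCP : Disjoint C P) (hk : 1 ≤ k)
    (hkP : k ≤ #P) : condSzasz K C P k ≤ condSzasz K ∅ (C ∪ P) k := by
  rw [condSzasz_eq_exp hK, condSzasz_empty_eq_exp hK, Real.exp_le_exp]
  exact (isSubmodular_logMinor hK).add_hanBound_contract_le (logMinor_empty K) hCP hk hkP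

theorem principalMinor_union_eq_condSzasz_iff (hK : K.PosDef) (hCP : Disjoint C P) (hk : 1 ≤ k)
    (hkP : k < #P) :
    principalMinor K (C ∪ P) = condSzasz K C P k ↔
      ∀ x ∈ P, ∀ y ∈ P, x ≠ y → condCov K C x y = 0 := by
  have hpos : ∀ S ⊆ P, 0 < principalMinor (condCov K C) S := fun S hS =>
    principalMinor_condCov_pos hK (hCP.mono_right hS)
  have hlog : ∀ S ⊆ P, contract (logMinor K) C S = logMinor (condCov K C) S := fun S hS =>
    contract_logMinor hK (hCP.mono_right hS)
  rw [principalMinor_union_eq_exp hK, condSzasz_eq_exp hK, Real.exp_eq_exp, add_right_inj]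
  constructor
  · intro h x hx y hy hxy
    have hxyP : {x, y} ⊆ P := insert_subset hx (singleton_subset_iff.2 hy)
    rw [← logMinor_pair_eq_iff (isSymm_condCov (isSymm_of_posDef hK)) hxy fun S hS =>
      hpos S (hS.trans hxyP), ← hlog _ hxyP, ← hlog _ (by simpa), ← hlog _ (by simpa)]
    exact ((isSubmodular_logMinor hK).contract C).pair_eq_of_eq_hanBound contract_empty_right
      hk hkP h hx hy hxy
  · intro h
    have hsum : ∀ S ⊆ P, contract (logMinor K) C S = ∑ x ∈ S, Real.log (condCov K C x x) := by
      intro S hS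
      rw [hlog S hS]
      exact logMinor_eq_sum (fun x hx => hpos {x} (singleton_subset_iff.2 (hS hx)))
        fun x hx y hy => h x (hS hx) y (hS hy)
    rw [hanBound_congr fun S hS => hsum S (mem_powersetCard.1 hS).1, hsum P Subset.rfl,
      hanBound_sum _ hk hkP.le]

theorem condSzasz_eq_condSzasz_empty (hK : K.PosDef) (hCP : Disjoint C P) (hk : 1 ≤ k)
    (hkP : k ≤ #P)
    (h : ∀ x ∈ C ∪ P, ∀ y ∈ C ∪ P, x ≠ y → (x ∈ C ∨ 2 ≤ k) → K x y = 0) :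
    condSzasz K C P k = condSzasz K ∅ (C ∪ P) k := by
  have hsum : ∀ D ⊆ C, ∀ S ⊆ C ∪ P, #S ≤ k →
      logMinor K (D ∪ S) = ∑ x ∈ D ∪ S, Real.log (K x x) := by
    intro D hD S hS hSk
    have hDS : D ∪ S ⊆ C ∪ P := union_subset (hD.trans subset_union_left) hS
    refine logMinor_eq_sum (fun x _ => principalMinor_pos hK {x}) fun x hx y hy hxy => ?_
    by_cases hyC : y ∈ C
    · rw [← (isSymm_of_posDef hK).apply]
      exact h y (hDS hy) x (hDS hx) hxy.symm (.inl hyC)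
    · have hyS : y ∈ S := (mem_union.1 hy).resolve_left fun hyD => hyC (hD hyD)
      refine h x (hDS hx) y (hDS hy) hxy ((mem_union.1 hx).imp (fun hxD => hD hxD) fun hxS => ?_)
      exact (one_lt_card.2 ⟨x, hxS, y, hyS, hxy⟩).trans_le hSk
  have hC : logMinor K C = ∑ x ∈ C, Real.log (K x x) := by
    simpa only [union_empty] using hsum C Subset.rfl ∅ (empty_subset _) (Nat.zero_le k)
  have hleft : ∀ S ∈ P.powersetCard k,
      contract (logMinor K) C S = ∑ x ∈ S, Real.log (K x x) := by
    intro S hS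
    obtain ⟨hSP, hSk⟩ := mem_powersetCard.1 hS
    rw [contract, hsum C Subset.rfl S (hSP.trans subset_union_right) hSk.le, hC,
      sum_union (hCP.mono_right hSP), add_sub_cancel_left]
  have hright : ∀ S ∈ (C ∪ P).powersetCard k, logMinor K S = ∑ x ∈ S, Real.log (K x x) := by
    intro S hS
    obtain ⟨hSCP, hSk⟩ := mem_powersetCard.1 hS
    simpa only [empty_union] using hsum ∅ (empty_subset C) S hSCP hSk.le
  rw [condSzasz_eq_exp hK, condSzasz_empty_eq_exp hK, hanBound_congr hleft,
    hanBound_congr hright, hanBound_sum _ hk hkP, hC,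
    hanBound_sum _ hk (hkP.trans (card_le_card subset_union_right)), sum_union hCP]

theorem condSzasz_eq_condSzasz_empty_iff (hK : K.PosDef) (hCP : Disjoint C P) (hC : C.Nonempty)
    (hk : 1 ≤ k) (hkP : k ≤ #P) :
    condSzasz K C P k = condSzasz K ∅ (C ∪ P) k ↔
      ∀ x ∈ C ∪ P, ∀ y ∈ C ∪ P, x ≠ y → (x ∈ C ∨ 2 ≤ k) → K x y = 0 := by
  refine ⟨fun h x hx y hy hxy hxk => ?_, condSzasz_eq_condSzasz_empty hK hCP hk hkP⟩
  rw [condSzasz_eq_exp hK, condSzasz_empty_eq_exp hK, Real.exp_eq_exp] at h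
  rw [← logMinor_pair_eq_iff (isSymm_of_posDef hK) hxy fun S _ => principalMinor_pos hK S]
  exact (isSubmodular_logMinor hK).pair_eq_of_add_hanBound_contract_eq (logMinor_empty K) hCP hC
    hk hkP h hx hy hxy hxk

theorem condSzasz_one (K : Matrix ι ι ℝ) (C P : Finset ι) :
    condSzasz K C P 1 =
      principalMinor K C * ∏ i ∈ P, principalMinor K ({i} ∪ C) / principalMinor K C := by
  simp [condSzasz, powersetCard_one]

theorem theorem4_general [Fintype ι] (hK : K.PosDef) (P : Finset ι) (hk : 1 ≤ k) (hkP : k ≤ #P) :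
    K.det ≤ condSzasz K Pᶜ P k ∧
    condSzasz K Pᶜ P k ≤ condSzasz K ∅ univ k ∧
    (k < #P →
      (K.det = condSzasz K Pᶜ P k ↔ ((condCov K Pᶜ).submatrix ((↑) : P → ι) (↑)).IsDiag)) ∧
    (k = 1 → #P < Fintype.card ι →
      (condSzasz K Pᶜ P k = condSzasz K ∅ univ k ↔
        K.submatrix ((↑) : P → ι) ((↑) : ↥Pᶜ → ι) = 0 ∧
        (K.submatrix ((↑) : ↥Pᶜ → ι) (↑)).IsDiag)) ∧
    (2 ≤ k → #P < Fintype.card ι →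
      (condSzasz K Pᶜ P k = condSzasz K ∅ univ k ↔ K.IsDiag)) ∧
    (#P = Fintype.card ι → condSzasz K Pᶜ P k = condSzasz K ∅ univ k) ∧
    (k = 1 →
      condSzasz K Pᶜ P k =
        principalMinor K Pᶜ *
          ∏ i ∈ P, principalMinor K ({i} ∪ Pᶜ) / principalMinor K Pᶜ) := by
  have hunion : Pᶜ ∪ P = univ := by rw [union_comm, union_compl]
  have hdisj : Disjoint Pᶜ P := disjoint_compl_left
  have hne : #P < Fintype.card ι → Pᶜ.Nonempty := fun h => by
    rwa [← card_pos, card_compl, Nat.sub_pos_iff_lt]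
  have hiff : #P < Fintype.card ι → (condSzasz K Pᶜ P k = condSzasz K ∅ univ k ↔
      ∀ x y, x ≠ y → (x ∈ Pᶜ ∨ 2 ≤ k) → K x y = 0) := fun h => by
    simpa only [hunion, mem_univ, true_imp_iff] using
      condSzasz_eq_condSzasz_empty_iff hK hdisj (hne h) hk hkP
  rw [← principalMinor_univ, ← hunion]
  refine ⟨principalMinor_union_le_condSzasz hK _ hk hkP,
    condSzasz_le_condSzasz_empty hK hdisj hk hkP, fun hk' => ?_, ?_, ?_, fun hP => ?_, ?_⟩
  · rw [isDiag_submatrix_coe_iff]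
    exact principalMinor_union_eq_condSzasz_iff hK hdisj hk hk'
  · rintro rfl hP
    rw [hunion, hiff hP, ← forall_mem_compl_eq_zero_iff (isSymm_of_posDef hK)]
    simp
  · intro hk2 hP
    rw [hunion, hiff hP]
    simp only [hk2, or_true, true_imp_iff]
    rfl
  · rw [(card_eq_iff_eq_univ P).1 hP, compl_univ, empty_union]
  · rintro rfl
    exact condSzasz_one K Pᶜ P

end CondSzasz

theorem card_firstIdx {n p : ℕ} (hpn : p ≤ n) : Finset.card (firstIdx n p) = p := by
  simp [firstIdx, Fin.card_filter_val_lt, hpn]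

theorem condSzaszBound_eq {n p : ℕ} (K : Matrix (Fin n) (Fin n) ℝ) (hpn : p ≤ n) (k : ℕ) :
    condSzaszBound K p k = condSzasz K (firstIdx n p)ᶜ (firstIdx n p) k := by
  rw [condSzasz, card_firstIdx hpn]
  rfl

theorem szaszBound_eq {n : ℕ} (K : Matrix (Fin n) (Fin n) ℝ) (k : ℕ) :
    szaszBound K k = condSzasz K ∅ Finset.univ k := by
  simp only [condSzasz, principalMinor_empty, one_mul, div_one, Finset.union_empty,
    Finset.card_fin]
  rfl

theorem theorem4 (n : ℕ) (K : Matrix (Fin n) (Fin n) ℝ) (hK : K.PosDef)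
    (k p : ℕ) (hk : 1 ≤ k) (hkp : k ≤ p) (hpn : p ≤ n) :
    K.det ≤ condSzaszBound K p k ∧
    condSzaszBound K p k ≤ szaszBound K k ∧
    (k < p → (K.det = condSzaszBound K p k ↔ (schurCompl K (firstIdx n p)).IsDiag)) ∧
    (k = 1 → p < n →
      (condSzaszBound K p k = szaszBound K k ↔
        subMat K (firstIdx n p) (firstIdx n p)ᶜ = 0 ∧
        (subMat K (firstIdx n p)ᶜ (firstIdx n p)ᶜ).IsDiag)) ∧
    (2 ≤ k → p < n → (condSzaszBound K p k = szaszBound K k ↔ K.IsDiag)) ∧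
    (p = n → condSzaszBound K p k = szaszBound K k) ∧
    (k = 1 →
      condSzaszBound K p k =
        minorDet K (firstIdx n p)ᶜ *
          ∏ i ∈ firstIdx n p,
            minorDet K ({i} ∪ (firstIdx n p)ᶜ) / minorDet K (firstIdx n p)ᶜ) := by
  have h := theorem4_general hK (firstIdx n p) hk (by rwa [card_firstIdx hpn])
  rwa [card_firstIdx hpn, Fintype.card_fin, ← condSzaszBound_eq K hpn, ← szaszBound_eq] at h
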